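/- Let $m,n\ge 1$ be integers. Number the vertices of a convex $(mn+2)$-gon counter-clockwise by $0,1,\dots,mn+1$. An $(m+2)$-angulation is a set of pairwise noncrossing diagonals that cut the polygon into regions with $m+2$ sides each. Let $Q_0$ be the fan whose diagonals are, for $1\le k\le n-1$, the diagonal number $k$ joining $0$ to $km+1$. Let $\mathcal P_{m,n}$ be the set of $(m+2)$-angulations with the relation $\le$ that is the reflexive transitive closure of the following moves $Q\to Q'$: a diagonal of $Q$ belonging to $Q_0$ is removed and replaced by another diagonal so that the result $Q'$ is again an $(m+2)$-angulation (a flip). Consider the polynomial ring over $\mathbb Q$ in the $mn$ variables $t_i$, where $t$ runs over $m$ letters $x<y<\dots<\omega$ and $1\le i\le n$. Label the vertices $2,3,\dots,mn+1$ cyclically by $x,y,\dots,\omega,x,y,\dots$ (so that vertex $mn+1$ receives $\omega$), and give vertex $1$ the letter $\omega$. For a diagonal $d$ joining vertices $a<b$, put $m_d=1$ if $d$ is a diagonal of $Q_0$; otherwise put $m_d=v_{j+1}-u_i$, where $u$ and $v$ are the letters of $a$ and $b$, and $i$ and $j$ are the smallest and largest numbers of the diagonals of $Q_0$ crossed by $d$.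 For an $(m+2)$-angulation $Q$ let $P_Q=\prod_{d\in Q} m_d$. Then $\le$ is a partial order, the map $Q\mapsto P_Q$ is injective, and for all $(m+2)$-angulations $Q,Q'$ one has $P_Q\mid P_{Q'}$ in the polynomial ring if and only if $Q\le Q'$. In other words, the set of polynomials $P_Q$, ordered by divisibility, is isomorphic as a poset to $\mathcal P_{m,n}$ via $Q\mapsto P_Q$. -/

import Mathlib

/-! The vertices of the `(m * n + 2)`-gon are `0, 1, ..., m * n + 1`, numbered counter-clockwise
from the apex `0`. A diagonal joining `a < b` is the pair `(a, b)`. -/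

/-- The pair `d` is a diagonal of the convex polygon with vertices `0, ..., N - 1`:
its two ends are distinct and not neighbours. -/
def IsDiagonal (N : ℕ) (d : ℕ × ℕ) : Prop :=
  d.1 + 1 < d.2 ∧ d.2 < N ∧ ¬ (d.1 = 0 ∧ d.2 + 1 = N)

/-- The vertices `v` and `w` lie strictly on different sides of the chord `d` (where `d.1 < d.2`). -/
def Separates (d : ℕ × ℕ) (v w : ℕ) : Prop :=
  (d.1 < v ∧ v < d.2 ∧ (w < d.1 ∨ d.2 < w)) ∨ (d.1 < w ∧ w < d.2 ∧ (v < d.1 ∨ d.2 < v))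

/-- The diagonals `d` and `e` intersect in the interior of the polygon. -/
def Crosses (d e : ℕ × ℕ) : Prop := Separates d e.1 e.2

/-- `S` is the vertex set of one of the regions into which the set `D` of (noncrossing) diagonals
cuts the polygon with vertices `0, ..., N - 1`: a maximal set of vertices no two of which are
separated by a diagonal in `D`. The number of sides of the region is the cardinality of `S`. -/
def IsRegion (N : ℕ) (D : Finset (ℕ × ℕ)) (S : Finset ℕ) : Prop :=
  Maximal (fun T : Finset ℕ =>
    T ⊆ Finset.range N ∧ ∀ d ∈ D, ∀ v ∈ T, ∀ w ∈ T, ¬ Separates d v w) S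

/-- The `(m + 2)`-angulations of the `(m * n + 2)`-gon: sets of pairwise noncrossing diagonals
that cut the polygon into regions with `m + 2` sides. -/
@[ext]
structure MAngulation (m n : ℕ) where
  diags : Finset (ℕ × ℕ)
  isDiagonal : ∀ d ∈ diags, IsDiagonal (m * n + 2) d
  noncrossing : ∀ d ∈ diags, ∀ e ∈ diags, ¬ Crosses d e
  card_region : ∀ S : Finset ℕ, IsRegion (m * n + 2) diags S → S.card = m + 2

/-- The `k`-th diagonal of the fan `Q₀` with apex `0` (for `1 ≤ k ≤ n - 1`). -/
def fanDiag (m k : ℕ) : ℕ × ℕ := (0, k * m + 1)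

/-- The diagonals of the fan `Q₀`. -/
def fan (m n : ℕ) : Finset (ℕ × ℕ) := (Finset.Icc 1 (n - 1)).image (fanDiag m)

namespace MAngulation

/-- `Q'` is obtained from `Q` by flipping one diagonal of `Q` that belongs to the fan: it is removed
and replaced by another diagonal, so that the result is again an `(m + 2)`-angulation. -/
def FlipUp {m n : ℕ} (Q Q' : MAngulation m n) : Prop :=
  ∃ d ∈ Q.diags, d ∈ fan m n ∧ ∃ d' ∉ Q.diags, Q'.diags = insert d' (Q.diags.erase d)

/-- The order of `P_{m,n}`: the reflexive transitive closure of the flips of fan diagonals. -/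
def PLE {m n : ℕ} : MAngulation m n → MAngulation m n → Prop :=
  Relation.ReflTransGen FlipUp

end MAngulation

/-- The letter of the vertex `k ≥ 1`; the `m` letters `x < y < ... < ω` are `0, ..., m - 1`.
The vertices `1, 2, 3, ...` receive `ω, x, y, ...`, and the last vertex `m * n + 1`
receives `ω`. -/
def letter (m : ℕ) [NeZero m] (k : ℕ) : Fin m := Fin.ofNat m (k + m - 2)

/-- The labels of the diagonals of the fan that are crossed by `d`. -/
def crossedLabels (m n : ℕ) (d : ℕ × ℕ) : Set ℕ :=
  {k | 1 ≤ k ∧ k ≤ n - 1 ∧ Crosses d (fanDiag m k)}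

/-- The variable `t_i`, for a letter `t` and an index `1 ≤ i ≤ n`. -/
noncomputable def tVar {m : ℕ} (n : ℕ) [NeZero n] (t : Fin m) (i : ℕ) :
    MvPolynomial (Fin m × Fin n) ℚ :=
  MvPolynomial.X (t, Fin.ofNat n (i - 1))

/-- The polynomial `m_d`: it is `1` for a diagonal of the fan and otherwise `v_{j+1} - u_i`, where
`u` and `v` are the letters of the first and of the last end of `d`, and `i` and `j` are the smallest
and the largest label of a fan diagonal crossed by `d`. -/
noncomputable def diagPoly (m n : ℕ) [NeZero m] [NeZero n] (d : ℕ × ℕ) :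
    MvPolynomial (Fin m × Fin n) ℚ :=
  if d ∈ fan m n then 1
  else tVar n (letter m d.2) (sSup (crossedLabels m n d) + 1)
    - tVar n (letter m d.1) (sInf (crossedLabels m n d))

/-- The polynomial `P_Q`, the product of the `m_d` over the diagonals `d` of `Q`. -/
noncomputable def MAngulation.poly {m n : ℕ} [NeZero m] [NeZero n] (Q : MAngulation m n) :
    MvPolynomial (Fin m × Fin n) ℚ :=
  ∏ d ∈ Q.diags, diagPoly m n d

/-!
Both relations are compared with inclusion of the sets `offFan Q` of diagonals of `Q` outside the
fan.

*Counting.* To a noncrossing family of chords add the side joining the first and the last vertex.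
Each chord then has a cell directly below it; these cells are exactly the regions
(`isRegion_cell`, `exists_cell_of_isRegion`). The lengths `b - a` of the chords telescope along the
cells (`IsDissection.length_eq`). Calling a diagonal admissible if its length is congruent to `1`
modulo `m`, this shows that the `(m + 2)`-angulations are the noncrossing sets of `n - 1` admissible
diagonals, and that no noncrossing set of admissible diagonals is larger (`card_add_one_le`,
`MAngulation.ofCard`, `MAngulation.card_diags`). In particular an admissible diagonal that crosses
no diagonal of `Q` lies in `Q`, so `offFan Q` determines `Q`.

*Order.* A flip of a fan diagonal can only enlarge `offFan Q`. Conversely, if `offFan Q` is a proper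
subset of `offFan Q'`, take a shortest diagonal `d` in the difference. It crosses some diagonal of
`Q`, only fan diagonals of `Q`, and by counting the diagonals below `d` not more than one of them
(`MAngulation.eq_of_crosses_of_shortest`). Exchanging this one for `d` is a flip, and iterating
reaches `Q'` (`MAngulation.ple_iff_offFan_subset`).

*Divisibility.* For `d` off the fan, `diagPoly d` is a difference of two distinct variables, hence
prime, and the two variables determine `d`: the letter of an end and the index attached to it give
its residue modulo `m` and its quotient. Unique factorization turns divisibility of the
products into inclusion of the sets `offFan` (`MAngulation.poly_dvd_iff_offFan_subset`).
-/

/-! ### Cells of a noncrossing family of chords -/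

/-- A finite family of pairwise noncrossing chords, none of which joins neighbouring vertices.
The chord joining the first and the last vertex of a polygon is allowed. -/
structure IsDissection (E : Finset (ℕ × ℕ)) : Prop where
  long : ∀ d ∈ E, d.1 + 1 < d.2
  noncrossing : ∀ d ∈ E, ∀ e ∈ E, ¬ Crosses d e

/-- The chords of `E` that lie in the interval `[a, b]`. -/
def within (E : Finset (ℕ × ℕ)) (a b : ℕ) : Finset (ℕ × ℕ) :=
  E.filter fun d => a ≤ d.1 ∧ d.2 ≤ b

/-- The vertices strictly between `a` and `b` that are not cut off by a chord of `E` lying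
in `[a, b]`. -/
def exposed (E : Finset (ℕ × ℕ)) (a b : ℕ) : Finset ℕ :=
  (Finset.Ioo a b).filter fun v => ∀ d ∈ E, a ≤ d.1 → d.2 ≤ b → ¬ (d.1 < v ∧ v < d.2)

/-- The number of vertices, other than the ends of `d`, of the cell directly below the chord `d`,
that is, on the side of `d` facing away from the chord joining the extreme vertices. -/
def cellSize (E : Finset (ℕ × ℕ)) (d : ℕ × ℕ) : ℕ :=
  (exposed (E.erase d) d.1 d.2).card

theorem mem_within {E : Finset (ℕ × ℕ)} {a b : ℕ} {d : ℕ × ℕ} :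
    d ∈ within E a b ↔ d ∈ E ∧ a ≤ d.1 ∧ d.2 ≤ b := by
  simp [within]

theorem mem_exposed {E : Finset (ℕ × ℕ)} {a b v : ℕ} :
    v ∈ exposed E a b ↔
      (a < v ∧ v < b) ∧ ∀ d ∈ E, a ≤ d.1 → d.2 ≤ b → ¬ (d.1 < v ∧ v < d.2) := by
  simp [exposed]

theorem not_crosses_iff {d e : ℕ × ℕ} (he : e.1 < e.2) :
    ¬ Crosses d e ↔
      d.2 ≤ e.1 ∨ e.2 ≤ d.1 ∨ (d.1 ≤ e.1 ∧ e.2 ≤ d.2) ∨ (e.1 ≤ d.1 ∧ d.2 ≤ e.2) := by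
  unfold Crosses Separates
  omega

namespace IsDissection

variable {E : Finset (ℕ × ℕ)}

theorem lt (hE : IsDissection E) {d : ℕ × ℕ} (hd : d ∈ E) : d.1 < d.2 :=
  (Nat.lt_succ_self _).trans (hE.long d hd)

theorem mono (hE : IsDissection E) {F : Finset (ℕ × ℕ)} (h : F ⊆ E) : IsDissection F :=
  ⟨fun d hd => hE.long d (h hd), fun d hd e he => hE.noncrossing d (h hd) e (h he)⟩

theorem insert_chord (hE : IsDissection E) {d : ℕ × ℕ} (hd : d.1 + 1 < d.2)
    (h : ∀ e ∈ E, ¬ Crosses d e) : IsDissection (insert d E) := by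
  refine ⟨fun e he => ?_, fun e he f hf => ?_⟩
  · rcases Finset.mem_insert.1 he with rfl | he
    exacts [hd, hE.long e he]
  · rcases Finset.mem_insert.1 he with rfl | he' <;> rcases Finset.mem_insert.1 hf with rfl | hf'
    · rw [not_crosses_iff (by omega)]
      omega
    · exact h f hf'
    · have h1 := hE.lt he'
      have h2 := h e he'
      rw [not_crosses_iff h1] at h2
      rw [not_crosses_iff (by omega)]
      omega
    · exact hE.noncrossing e he' f hf'

/-- Below every chord, and in every interval that is not itself a chord, some interior vertex is
exposed: the far end of the longest chord starting at `a`, or the neighbour of `a`. -/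
theorem exposed_nonempty (hE : IsDissection E) {a b : ℕ} (hab : a + 1 < b) (h : (a, b) ∉ E) :
    (exposed E a b).Nonempty := by
  classical
  let T : Finset ℕ := (Finset.Ioo a b).filter fun v => v = a + 1 ∨ (a, v) ∈ E
  have hT : T.Nonempty := ⟨a + 1, by simp [T]; omega⟩
  obtain ⟨hv, hv'⟩ := Finset.mem_filter.1 (T.max'_mem hT)
  have hmax := T.le_max'
  set v := T.max' hT
  rw [Finset.mem_Ioo] at hv
  refine ⟨v, mem_exposed.2 ⟨hv, ?_⟩⟩
  rintro ⟨x, y⟩ hd h1 h2 ⟨h3, h4⟩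
  have hxy := hE.lt hd
  dsimp only at h1 h2 h3 h4 hxy
  have hxa : x = a := by
    rcases hv' with hv' | hv'
    · omega
    · have := (not_crosses_iff hxy).1 (hE.noncrossing _ hv' _ hd)
      dsimp only at this
      omega
  subst hxa
  rcases h2.lt_or_eq with h2 | h2
  · have := hmax y (Finset.mem_filter.2 ⟨Finset.mem_Ioo.2 ⟨hxy, h2⟩, Or.inr hd⟩)
    omega
  · exact h (h2 ▸ hd)

theorem within_eq_union {a b v : ℕ} (hv : v ∈ exposed E a b) :
    within E a b = within E a v ∪ within E v b := by
  obtain ⟨⟨h1, h2⟩, h3⟩ := mem_exposed.1 hv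
  ext d
  simp only [mem_within, Finset.mem_union]
  constructor
  · rintro ⟨hd, h4, h5⟩
    have := h3 d hd h4 h5
    by_cases hc : v ≤ d.1
    · exact Or.inr ⟨hd, hc, h5⟩
    · exact Or.inl ⟨hd, h4, by omega⟩
  · rintro (⟨hd, h4, h5⟩ | ⟨hd, h4, h5⟩)
    exacts [⟨hd, h4, by omega⟩, ⟨hd, by omega, h5⟩]

theorem disjoint_within (hE : IsDissection E) (a b v : ℕ) :
    Disjoint (within E a v) (within E v b) := by
  rw [Finset.disjoint_left]
  intro d h1 h2
  rw [mem_within] at h1 h2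
  have := hE.lt h1.1
  omega

theorem exposed_card_split {a b v : ℕ} (hv : v ∈ exposed E a b) :
    (exposed E a b).card = (exposed E a v).card + (exposed E v b).card + 1 := by
  obtain ⟨⟨h1, h2⟩, h3⟩ := mem_exposed.1 hv
  have key : exposed E a b = insert v (exposed E a v ∪ exposed E v b) := by
    ext u
    simp only [Finset.mem_insert, Finset.mem_union]
    constructor
    · intro hu
      obtain ⟨⟨h4, h5⟩, h6⟩ := mem_exposed.1 hu
      rcases lt_trichotomy u v with h | h | h
      · exact Or.inr (Or.inl (mem_exposed.2 ⟨⟨h4, h⟩, fun d hd h7 h8 => h6 d hd h7 (by omega)⟩))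
      · exact Or.inl h
      · exact Or.inr (Or.inr (mem_exposed.2 ⟨⟨h, h5⟩, fun d hd h7 h8 => h6 d hd (by omega) h8⟩))
    · rintro (rfl | hu | hu)
      · exact hv
      · obtain ⟨⟨h4, h5⟩, h6⟩ := mem_exposed.1 hu
        refine mem_exposed.2 ⟨⟨h4, by omega⟩, fun d hd h7 h8 h9 => ?_⟩
        have := h3 d hd h7 h8
        exact h6 d hd h7 (by omega) h9
      · obtain ⟨⟨h4, h5⟩, h6⟩ := mem_exposed.1 hu
        refine mem_exposed.2 ⟨⟨by omega, h5⟩, fun d hd h7 h8 h9 => ?_⟩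
        have := h3 d hd h7 h8
        exact h6 d hd (by omega) h8 h9
  rw [key, Finset.card_insert_of_notMem, Finset.card_union_of_disjoint]
  · rw [Finset.disjoint_left]
    intro u h4 h5
    rw [mem_exposed] at h4 h5
    omega
  · rw [Finset.mem_union, mem_exposed, mem_exposed]
    omega

theorem exposed_eq_empty {a b : ℕ} (h : (a, b) ∈ E) : exposed E a b = ∅ := by
  rw [Finset.eq_empty_iff_forall_notMem]
  intro v hv
  obtain ⟨h1, h2⟩ := mem_exposed.1 hv
  exact h2 _ h le_rfl le_rfl h1

theorem within_eq_insert {a b : ℕ} (h : (a, b) ∈ E) :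
    within E a b = insert (a, b) (within (E.erase (a, b)) a b) := by
  ext d
  simp only [mem_within, Finset.mem_insert, Finset.mem_erase]
  by_cases hd : d = (a, b)
  · simp [hd, h]
  · simp [hd]

theorem exposed_erase {a b a' b' : ℕ} (h : ¬ (a ≤ a' ∧ b' ≤ b)) :
    exposed (E.erase (a', b')) a b = exposed E a b := by
  ext v
  simp only [mem_exposed, Finset.mem_erase]
  refine and_congr_right fun _ => ⟨fun H d hd h1 h2 => H d ⟨?_, hd⟩ h1 h2,
    fun H d hd => H d hd.2⟩
  rintro rfl
  exact h ⟨h1, h2⟩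

theorem within_erase {a b a' b' : ℕ} (h : ¬ (a ≤ a' ∧ b' ≤ b)) :
    within (E.erase (a', b')) a b = within E a b := by
  ext d
  simp only [mem_within, Finset.mem_erase]
  refine ⟨fun H => ⟨H.1.2, H.2⟩, fun H => ⟨⟨?_, H.1⟩, H.2⟩⟩
  rintro rfl
  exact h H.2

/-- The length formula: the sides of the cells inside an interval telescope, so that its length is
the total size of the cells below the chords it contains, plus its exposed vertices, plus one. -/
theorem length_eq (hE : IsDissection E) {a b : ℕ} (hab : a < b) :
    b = a + ∑ d ∈ within E a b, cellSize E d + (exposed E a b).card + 1 := by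
  induction hL : b - a using Nat.strong_induction_on generalizing a b with
  | _ L ih =>
  -- Remove the chord `(a, b)` itself, and split at an exposed vertex.
  have core : b = a + ∑ d ∈ within (E.erase (a, b)) a b, cellSize E d
      + (exposed (E.erase (a, b)) a b).card + 1 := by
    have hE' : IsDissection (E.erase (a, b)) := hE.mono (Finset.erase_subset _ _)
    by_cases hab' : a + 1 < b
    · obtain ⟨v, hv⟩ := hE'.exposed_nonempty hab' (Finset.notMem_erase _ _)
      have hv' := (mem_exposed.1 hv).1
      rw [within_eq_union hv, exposed_card_split hv,
        Finset.sum_union (hE'.disjoint_within a b v), exposed_erase (by omega),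
        exposed_erase (by omega), within_erase (by omega), within_erase (by omega)]
      have h1 := ih (v - a) (by omega) hv'.1 rfl
      have h2 := ih (b - v) (by omega) hv'.2 rfl
      omega
    · have h1 : within (E.erase (a, b)) a b = ∅ := by
        rw [Finset.eq_empty_iff_forall_notMem]
        intro d hd
        rw [mem_within] at hd
        have := hE'.long d hd.1
        omega
      have h2 : exposed (E.erase (a, b)) a b = ∅ := by
        rw [Finset.eq_empty_iff_forall_notMem]
        intro v hv
        rw [mem_exposed] at hv
        omega
      rw [h1, h2]
      simp
      omega
  by_cases h : (a, b) ∈ E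
  · rw [within_eq_insert h, exposed_eq_empty h, Finset.sum_insert (by simp [mem_within])]
    rw [Finset.card_empty, cellSize]
    dsimp only
    omega
  · rwa [Finset.erase_eq_of_notMem h] at core

theorem cellSize_pos (hE : IsDissection E) {d : ℕ × ℕ} (hd : d ∈ E) : 0 < cellSize E d :=
  Finset.card_pos.2 <| (hE.mono (Finset.erase_subset _ _)).exposed_nonempty (hE.long d hd)
    (Finset.notMem_erase d E)

/-- If all chords have length congruent to `1` modulo `m`, then all cell sizes are multiples
of `m`. -/
theorem dvd_cellSize (hE : IsDissection E) {m : ℕ} (hm : ∀ d ∈ E, m ∣ d.2 - d.1 - 1)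
    {d : ℕ × ℕ} (hd : d ∈ E) : m ∣ cellSize E d := by
  induction hL : d.2 - d.1 using Nat.strong_induction_on generalizing d with
  | _ L ih =>
  have h1 := hE.length_eq (hE.lt hd)
  have hd' : (d.1, d.2) ∈ E := hd
  rw [within_eq_insert hd', exposed_eq_empty hd', Finset.sum_insert (by simp [mem_within]),
    Finset.card_empty] at h1
  have h2 : m ∣ ∑ e ∈ within (E.erase (d.1, d.2)) d.1 d.2, cellSize E e := by
    refine Finset.dvd_sum fun e he => ?_
    obtain ⟨he, h3, h4⟩ := mem_within.1 he
    obtain ⟨hne, he⟩ := Finset.mem_erase.1 he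
    refine ih (e.2 - e.1) ?_ he rfl
    have : ¬ (e.1 = d.1 ∧ e.2 = d.2) := fun h => hne (Prod.ext h.1 h.2)
    have := hE.lt he
    omega
  have h3 : d.2 - d.1 - 1
      = cellSize E d + ∑ e ∈ within (E.erase (d.1, d.2)) d.1 d.2, cellSize E e := by
    change d.2 = d.1 + (cellSize E d + _) + 0 + 1 at h1
    omega
  exact (Nat.dvd_add_left h2).1 (h3 ▸ hm d hd)

theorem le_cellSize (hE : IsDissection E) {m : ℕ} (hm : ∀ d ∈ E, m ∣ d.2 - d.1 - 1)
    {d : ℕ × ℕ} (hd : d ∈ E) : m ≤ cellSize E d :=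
  Nat.le_of_dvd (hE.cellSize_pos hd) (hE.dvd_cellSize hm hd)

theorem card_within_le (hE : IsDissection E) {m : ℕ} (hm : ∀ d ∈ E, m ∣ d.2 - d.1 - 1)
    {a b : ℕ} (hab : a < b) : a + m * (within E a b).card + 1 ≤ b := by
  have h1 := hE.length_eq hab
  have h2 : (within E a b).card • m ≤ ∑ d ∈ within E a b, cellSize E d :=
    Finset.card_nsmul_le_sum _ _ _ fun d hd => hE.le_cellSize hm (mem_within.1 hd).1
  rw [smul_eq_mul, mul_comm] at h2
  omega

theorem card_within_eq (hE : IsDissection E) {m : ℕ} (hm : ∀ d ∈ E, cellSize E d = m)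
    {d : ℕ × ℕ} (hd : d ∈ E) : d.1 + m * (within E d.1 d.2).card + 1 = d.2 := by
  have h1 := hE.length_eq (hE.lt hd)
  have hd' : (d.1, d.2) ∈ E := hd
  rw [exposed_eq_empty hd', Finset.sum_congr rfl fun e he => hm e (mem_within.1 he).1,
    Finset.sum_const, smul_eq_mul, Finset.card_empty, mul_comm] at h1
  omega

end IsDissection

/-! ### Regions are cells -/

/-- The vertex set of the cell directly below the chord `d` of `E`. -/
def cell (E : Finset (ℕ × ℕ)) (d : ℕ × ℕ) : Finset ℕ :=
  insert d.1 (insert d.2 (exposed (E.erase d) d.1 d.2))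

theorem card_cell {E : Finset (ℕ × ℕ)} {d : ℕ × ℕ} (hd : d.1 < d.2) :
    (cell E d).card = cellSize E d + 2 := by
  have h1 : d.2 ∉ exposed (E.erase d) d.1 d.2 := fun h => by
    have := (mem_exposed.1 h).1
    omega
  have h2 : d.1 ∉ insert d.2 (exposed (E.erase d) d.1 d.2) := fun h => by
    rcases Finset.mem_insert.1 h with h | h
    · omega
    · have := (mem_exposed.1 h).1
      omega
  rw [cell, Finset.card_insert_of_notMem h2, Finset.card_insert_of_notMem h1, cellSize]

theorem mem_cell {E : Finset (ℕ × ℕ)} {d : ℕ × ℕ} (hd : d.1 < d.2) {v : ℕ} :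
    v ∈ cell E d ↔ (d.1 ≤ v ∧ v ≤ d.2) ∧
      ∀ e ∈ E, e ≠ d → d.1 ≤ e.1 → e.2 ≤ d.2 → ¬ (e.1 < v ∧ v < e.2) := by
  simp only [cell, Finset.mem_insert, mem_exposed, Finset.mem_erase]
  constructor
  · rintro (rfl | rfl | ⟨h1, h2⟩)
    · exact ⟨⟨le_rfl, hd.le⟩, fun e _ _ _ _ => by omega⟩
    · exact ⟨⟨hd.le, le_rfl⟩, fun e _ _ _ _ => by omega⟩
    · exact ⟨⟨h1.1.le, h1.2.le⟩, fun e he hne => h2 e ⟨hne, he⟩⟩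
  · rintro ⟨h1, h2⟩
    by_cases h3 : v = d.1
    · exact Or.inl h3
    by_cases h4 : v = d.2
    · exact Or.inr (Or.inl h4)
    exact Or.inr (Or.inr ⟨by omega, fun e he => h2 e he.2 he.1⟩)

/-- A set of diagonals of the `N`-gon together with the side joining the first and the last vertex:
its chords correspond to the regions of the polygon, each chord to the region below it. -/
def withRoot (N : ℕ) (D : Finset (ℕ × ℕ)) : Finset (ℕ × ℕ) :=
  insert (0, N - 1) D

section Regions

variable {N : ℕ} {D : Finset (ℕ × ℕ)}

theorem root_notMem (hD : ∀ d ∈ D, IsDiagonal N d) (hN : 2 < N) : (0, N - 1) ∉ D := fun h => by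
  have := hD _ h
  unfold IsDiagonal at this
  omega

theorem isDissection_withRoot (hN : 2 < N) (hD : ∀ d ∈ D, IsDiagonal N d)
    (hnc : ∀ d ∈ D, ∀ e ∈ D, ¬ Crosses d e) : IsDissection (withRoot N D) := by
  refine IsDissection.insert_chord ⟨fun d hd => (hD d hd).1, hnc⟩ (by dsimp only; omega) ?_
  intro e he
  have h1 := (hD e he).1
  have h2 := (hD e he).2.1
  rw [not_crosses_iff (by omega)]
  dsimp only
  omega

theorem snd_lt_of_mem_withRoot (hN : 2 < N) (hD : ∀ d ∈ D, IsDiagonal N d) {d : ℕ × ℕ}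
    (hd : d ∈ withRoot N D) : d.2 < N := by
  rcases Finset.mem_insert.1 hd with rfl | hd
  · dsimp only
    omega
  · exact (hD d hd).2.1

/-- A chord strictly below another one is not the root side. -/
theorem mem_of_mem_withRoot (hN : 2 < N) (hD : ∀ d ∈ D, IsDiagonal N d) {d e : ℕ × ℕ}
    (hd : d ∈ withRoot N D) (he : e ∈ withRoot N D) (hne : e ≠ d) (h1 : d.1 ≤ e.1)
    (h2 : e.2 ≤ d.2) : e ∈ D := by
  rcases Finset.mem_insert.1 he with rfl | he
  · have := snd_lt_of_mem_withRoot hN hD hd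
    exact absurd (Prod.ext (by dsimp only at *; omega) (by dsimp only at *; omega)) hne
  · exact he

theorem isRegion_cell (hN : 2 < N) (hD : ∀ d ∈ D, IsDiagonal N d)
    (hnc : ∀ d ∈ D, ∀ e ∈ D, ¬ Crosses d e) {d : ℕ × ℕ} (hd : d ∈ withRoot N D) :
    IsRegion N D (cell (withRoot N D) d) := by
  have hE := isDissection_withRoot hN hD hnc
  have hlt := hE.lt hd
  have hdN := snd_lt_of_mem_withRoot hN hD hd
  refine ⟨⟨fun v hv => ?_, fun e he v hv w hw => ?_⟩, fun T hT hle u hu => ?_⟩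
  · have := ((mem_cell hlt).1 hv).1
    exact Finset.mem_range.2 (by omega)
  · have he' : e ∈ withRoot N D := Finset.mem_insert_of_mem he
    obtain ⟨hv1, hv2⟩ := (mem_cell hlt).1 hv
    obtain ⟨hw1, hw2⟩ := (mem_cell hlt).1 hw
    have hc := (not_crosses_iff (hE.lt he')).1 (hE.noncrossing d hd e he')
    unfold Separates
    by_cases hne : e = d
    · subst hne
      omega
    have h1 := hv2 e he' hne
    have h2 := hw2 e he' hne
    omega
  · have huN := Finset.mem_range.1 (hT.1 hu)
    have h1 : d.1 ∈ T := hle ((mem_cell hlt).2 ⟨⟨le_rfl, hlt.le⟩, fun e _ _ _ _ => by omega⟩)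
    have h2 : d.2 ∈ T := hle ((mem_cell hlt).2 ⟨⟨hlt.le, le_rfl⟩, fun e _ _ _ _ => by omega⟩)
    refine (mem_cell hlt).2 ⟨?_, fun e he hne h3 h4 h5 => ?_⟩
    · rcases Finset.mem_insert.1 hd with rfl | hdD
      · dsimp only
        omega
      -- A vertex outside `[d.1, d.2]` is separated by `d` from the exposed vertices below `d`.
      obtain ⟨v, hv⟩ := (hE.mono (Finset.erase_subset d _)).exposed_nonempty (hE.long d hd)
        (Finset.notMem_erase d _)
      have hv' := (mem_exposed.1 hv).1
      have hvT : v ∈ T := hle (Finset.mem_insert_of_mem (Finset.mem_insert_of_mem hv))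
      have := hT.2 d hdD v hvT u hu
      unfold Separates at this
      omega
    · have heD := mem_of_mem_withRoot hN hD hd he hne h3 h4
      have h6 := hT.2 e heD u hu _ h1
      have h7 := hT.2 e heD u hu _ h2
      unfold Separates at h6 h7
      exact hne (Prod.ext (by omega) (by omega))

/-- Every region is the cell below the shortest chord that spans it. -/
theorem exists_cell_of_isRegion (hN : 2 < N) (hD : ∀ d ∈ D, IsDiagonal N d)
    (hnc : ∀ d ∈ D, ∀ e ∈ D, ¬ Crosses d e) {S : Finset ℕ} (hS : IsRegion N D S) :
    ∃ d ∈ withRoot N D, S = cell (withRoot N D) d := by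
  have hE := isDissection_withRoot hN hD hnc
  have hroot : (0, N - 1) ∈ (withRoot N D).filter fun d => ∀ v ∈ S, d.1 ≤ v ∧ v ≤ d.2 := by
    refine Finset.mem_filter.2 ⟨Finset.mem_insert_self _ _, fun v hv => ?_⟩
    have := Finset.mem_range.1 (hS.prop.1 hv)
    dsimp only
    omega
  obtain ⟨d, hd, hmin⟩ := Finset.exists_min_image _ (fun d : ℕ × ℕ => d.2 - d.1) ⟨_, hroot⟩
  obtain ⟨hd, hspan⟩ := Finset.mem_filter.1 hd
  refine ⟨d, hd, hS.eq_of_le (isRegion_cell hN hD hnc hd).prop fun v hv =>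
    (mem_cell (hE.lt hd)).2 ⟨hspan v hv, fun e he hne h1 h2 h3 => hne ?_⟩⟩
  have heD := mem_of_mem_withRoot hN hD hd he hne h1 h2
  have := hmin e (Finset.mem_filter.2 ⟨he, fun w hw => by
    have := hS.prop.2 e heD v hv w hw
    unfold Separates at this
    omega⟩)
  have := hE.lt he
  exact Prod.ext (by omega) (by omega)

end Regions

/-! ### Numerical characterization of `(m + 2)`-angulations -/

section Count

variable {m n : ℕ}

theorem two_lt_card_vertices (m n : ℕ) [NeZero m] [NeZero n] : 2 < m * n + 2 := by
  have := Nat.mul_pos (NeZero.pos m) (NeZero.pos n)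
  omega

theorem dvd_length_of_mem_withRoot {D : Finset (ℕ × ℕ)} (hm : ∀ d ∈ D, m ∣ d.2 - d.1 - 1) :
    ∀ d ∈ withRoot (m * n + 2) D, m ∣ d.2 - d.1 - 1 := by
  intro d hd
  rcases Finset.mem_insert.1 hd with rfl | hd
  · exact ⟨n, by simp⟩
  · exact hm d hd

theorem within_withRoot {N : ℕ} {D : Finset (ℕ × ℕ)} (hN : 2 < N)
    (hD : ∀ d ∈ D, IsDiagonal N d) : within (withRoot N D) 0 (N - 1) = withRoot N D := by
  refine Finset.filter_true_of_mem fun d hd => ⟨Nat.zero_le _, ?_⟩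
  have := snd_lt_of_mem_withRoot hN hD hd
  omega

variable [NeZero m] [NeZero n]

/-- A noncrossing set of diagonals of length congruent to `1` modulo `m` has at most `n - 1`
elements. -/
theorem card_add_one_le {D : Finset (ℕ × ℕ)} (hD : ∀ d ∈ D, IsDiagonal (m * n + 2) d)
    (hnc : ∀ d ∈ D, ∀ e ∈ D, ¬ Crosses d e) (hm : ∀ d ∈ D, m ∣ d.2 - d.1 - 1) :
    D.card + 1 ≤ n := by
  have hN := two_lt_card_vertices m n
  have h := (isDissection_withRoot hN hD hnc).card_within_le (dvd_length_of_mem_withRoot hm)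
    (a := 0) (b := m * n + 2 - 1) (by omega)
  rw [within_withRoot hN hD, withRoot, Finset.card_insert_of_notMem (root_notMem hD hN)] at h
  exact Nat.le_of_mul_le_mul_left (by omega) (NeZero.pos m)

namespace MAngulation

/-- A noncrossing set of `n - 1` diagonals of length congruent to `1` modulo `m` is an
`(m + 2)`-angulation. -/
def ofCard (D : Finset (ℕ × ℕ)) (hD : ∀ d ∈ D, IsDiagonal (m * n + 2) d)
    (hnc : ∀ d ∈ D, ∀ e ∈ D, ¬ Crosses d e) (hm : ∀ d ∈ D, m ∣ d.2 - d.1 - 1)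
    (hcard : D.card + 1 = n) : MAngulation m n where
  diags := D
  isDiagonal := hD
  noncrossing := hnc
  card_region := by
    intro S hS
    have hN := two_lt_card_vertices m n
    have hE := isDissection_withRoot hN hD hnc
    obtain ⟨d, hd, rfl⟩ := exists_cell_of_isRegion hN hD hnc hS
    rw [card_cell (hE.lt hd)]
    -- All cells have size at least `m`, and the `n` sizes add up to `m * n`.
    have h := hE.length_eq (a := 0) (b := m * n + 2 - 1) (by omega)
    rw [within_withRoot hN hD,
      IsDissection.exposed_eq_empty (E := withRoot _ D) (Finset.mem_insert_self _ D),
      Finset.card_empty] at h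
    have hsum : ∑ _e ∈ withRoot (m * n + 2) D, m
        = ∑ e ∈ withRoot (m * n + 2) D, cellSize (withRoot (m * n + 2) D) e := by
      rw [Finset.sum_const, smul_eq_mul, withRoot,
        Finset.card_insert_of_notMem (root_notMem hD hN), hcard, mul_comm]
      rw [withRoot] at h
      omega
    rw [← (Finset.sum_eq_sum_iff_of_le fun e he =>
      hE.le_cellSize (dvd_length_of_mem_withRoot hm) he).1 hsum d hd]

variable (Q : MAngulation m n)

theorem isDissection : IsDissection (withRoot (m * n + 2) Q.diags) :=
  isDissection_withRoot (two_lt_card_vertices m n) Q.isDiagonal Q.noncrossing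

theorem cellSize_eq {d : ℕ × ℕ} (hd : d ∈ withRoot (m * n + 2) Q.diags) :
    cellSize (withRoot (m * n + 2) Q.diags) d = m := by
  have h := Q.card_region _
    (isRegion_cell (two_lt_card_vertices m n) Q.isDiagonal Q.noncrossing hd)
  rw [card_cell (Q.isDissection.lt hd)] at h
  omega

theorem dvd_length {d : ℕ × ℕ} (hd : d ∈ Q.diags) : m ∣ d.2 - d.1 - 1 :=
  ⟨_, by
    have h := Q.isDissection.card_within_eq (fun e he => Q.cellSize_eq he)
      (Finset.mem_insert_of_mem hd)
    have : d.2 - d.1 - 1 = m * (within (withRoot (m * n + 2) Q.diags) d.1 d.2).card := by omega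
    exact this⟩

theorem card_diags : Q.diags.card + 1 = n := by
  have hN := two_lt_card_vertices m n
  have h := Q.isDissection.card_within_eq (fun e he => Q.cellSize_eq he)
    (Finset.mem_insert_self (0, m * n + 2 - 1) Q.diags)
  dsimp only at h
  rw [within_withRoot hN Q.isDiagonal, withRoot,
    Finset.card_insert_of_notMem (root_notMem Q.isDiagonal hN)] at h
  exact Nat.eq_of_mul_eq_mul_left (NeZero.pos m) (by omega)

/-- Maximality: a diagonal of length congruent to `1` modulo `m` that crosses no diagonal of an
`(m + 2)`-angulation belongs to it. -/
theorem mem_of_not_crosses {d : ℕ × ℕ} (hd : IsDiagonal (m * n + 2) d)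
    (hm : m ∣ d.2 - d.1 - 1) (hnc : ∀ e ∈ Q.diags, ¬ Crosses d e) : d ∈ Q.diags := by
  by_contra hmem
  have hQ : IsDissection Q.diags := Q.isDissection.mono (Finset.subset_insert _ _)
  have h := card_add_one_le (m := m) (n := n) (D := insert d Q.diags)
    ((Finset.forall_mem_insert _ _ _).2 ⟨hd, Q.isDiagonal⟩)
    (hQ.insert_chord hd.1 hnc).noncrossing
    ((Finset.forall_mem_insert _ _ _).2 ⟨hm, fun e he => Q.dvd_length he⟩)
  rw [Finset.card_insert_of_notMem hmem] at h
  have := Q.card_diags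
  omega

end MAngulation

end Count

/-! ### Flips of fan diagonals -/

theorem mem_fan {m n : ℕ} {d : ℕ × ℕ} :
    d ∈ fan m n ↔ ∃ k, (1 ≤ k ∧ k ≤ n - 1) ∧ (0, k * m + 1) = d := by
  simp only [fan, Finset.mem_image, Finset.mem_Icc, fanDiag]

namespace MAngulation

variable {m n : ℕ}

/-- The diagonals of an `(m + 2)`-angulation that do not belong to the fan. -/
def offFan (Q : MAngulation m n) : Finset (ℕ × ℕ) :=
  Q.diags \ fan m n

theorem mem_offFan {Q : MAngulation m n} {d : ℕ × ℕ} :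
    d ∈ Q.offFan ↔ d ∈ Q.diags ∧ d ∉ fan m n :=
  Finset.mem_sdiff

theorem dvd_length_of_mem_fan {d : ℕ × ℕ} (hd : d ∈ fan m n) : m ∣ d.2 - d.1 - 1 := by
  obtain ⟨k, -, rfl⟩ := mem_fan.1 hd
  exact ⟨k, by simp [mul_comm]⟩

theorem fst_eq_zero_of_mem_fan {d : ℕ × ℕ} (hd : d ∈ fan m n) : d.1 = 0 := by
  obtain ⟨k, -, rfl⟩ := mem_fan.1 hd
  rfl

theorem FlipUp.offFan_subset {Q Q' : MAngulation m n} (h : FlipUp Q Q') :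
    Q.offFan ⊆ Q'.offFan := by
  obtain ⟨d, -, hf, d', -, h⟩ := h
  intro e he
  obtain ⟨he, hef⟩ := mem_offFan.1 he
  refine mem_offFan.2 ⟨?_, hef⟩
  rw [h]
  exact Finset.mem_insert_of_mem (Finset.mem_erase.2 ⟨fun h => hef (h ▸ hf), he⟩)

theorem PLE.offFan_subset {Q Q' : MAngulation m n} (h : PLE Q Q') : Q.offFan ⊆ Q'.offFan := by
  induction h with
  | refl => exact subset_rfl
  | tail _ h ih => exact ih.trans h.offFan_subset

variable [NeZero m] [NeZero n]

/-- The diagonals with end `0` of an `(m + 2)`-angulation belong to the fan. -/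
theorem fst_pos_of_mem_offFan {Q : MAngulation m n} {d : ℕ × ℕ} (hd : d ∈ Q.offFan) :
    0 < d.1 := by
  obtain ⟨hd, hf⟩ := mem_offFan.1 hd
  rw [Nat.pos_iff_ne_zero]
  intro h0
  obtain ⟨k, hk⟩ := Q.dvd_length hd
  obtain ⟨h1, h2, h3⟩ := Q.isDiagonal d hd
  have hm := NeZero.pos m
  refine hf (mem_fan.2 ⟨k, ⟨?_, ?_⟩, Prod.ext h0.symm ?_⟩)
  · rw [Nat.one_le_iff_ne_zero]
    rintro rfl
    omega
  · have h4 : m * k < m * n := by omega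
    have := Nat.lt_of_mul_lt_mul_left h4
    omega
  · dsimp only
    rw [mul_comm]
    omega

/-- The fan diagonals of an `(m + 2)`-angulation are determined by the remaining diagonals: they
are those that do not cross them. -/
theorem diags_subset_of_offFan_subset {Q Q' : MAngulation m n} (h : Q.offFan ⊆ Q'.offFan)
    (h' : Q'.offFan ⊆ Q.offFan) : Q.diags ⊆ Q'.diags := by
  intro d hd
  by_cases hf : d ∈ fan m n
  · refine Q'.mem_of_not_crosses (Q.isDiagonal d hd) (Q.dvd_length hd) fun e he => ?_
    by_cases he' : e ∈ fan m n
    · have := fst_eq_zero_of_mem_fan hf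
      have := fst_eq_zero_of_mem_fan he'
      rw [not_crosses_iff (by have := (Q'.isDiagonal e he).1; omega)]
      omega
    · exact Q.noncrossing d hd e (mem_offFan.1 (h' (mem_offFan.2 ⟨he, he'⟩))).1
  · exact (mem_offFan.1 (h (mem_offFan.2 ⟨hd, hf⟩))).1

theorem offFan_injective : Function.Injective (offFan : MAngulation m n → Finset (ℕ × ℕ)) :=
  fun _ _ h => MAngulation.ext <| (diags_subset_of_offFan_subset h.subset h.symm.subset).antisymm
    (diags_subset_of_offFan_subset h.symm.subset h.subset)

/-- A shortest diagonal `d` of `Q'` that is neither in `Q` nor in the fan crosses at most one fan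
diagonal of `Q`. Otherwise two of them would cut the interval spanned by `d` into three parts, and
the diagonals of `Q'` below `d`, all of which belong to `Q`, would be too many to fit in there. -/
theorem eq_of_crosses_of_shortest {Q Q' : MAngulation m n} {d e e' : ℕ × ℕ}
    (hd : d ∈ Q'.offFan)
    (hmin : ∀ f ∈ Q'.offFan, d.1 ≤ f.1 → f.2 ≤ d.2 → f ≠ d → f ∈ Q.diags)
    (he : e ∈ Q.diags) (he' : e' ∈ Q.diags) (hef : e ∈ fan m n) (hef' : e' ∈ fan m n)
    (hc : Crosses d e) (hc' : Crosses d e') : e = e' := by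
  by_contra hne
  wlog hlt : e.2 < e'.2 generalizing e e'
  · refine this he' he hef' hef hc' hc (Ne.symm hne) ?_
    have : e.2 ≠ e'.2 := fun h => hne <| Prod.ext
      ((fst_eq_zero_of_mem_fan hef).trans (fst_eq_zero_of_mem_fan hef').symm) h
    omega
  have h0 := fst_pos_of_mem_offFan hd
  have hdQ := (mem_offFan.1 hd).1
  have hlt_d := (Q'.isDiagonal d hdQ).1
  have hQ : IsDissection Q.diags := Q.isDissection.mono (Finset.subset_insert _ _)
  have hE' := Q'.isDissection
  have he1 := fst_eq_zero_of_mem_fan hef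
  have he1' := fst_eq_zero_of_mem_fan hef'
  have hle := (Q.isDiagonal e he).1
  have hle' := (Q.isDiagonal e' he').1
  have hx : d.1 < e.2 ∧ e.2 < d.2 := by
    unfold Crosses Separates at hc
    omega
  have hx' : d.1 < e'.2 ∧ e'.2 < d.2 := by
    unfold Crosses Separates at hc'
    omega
  -- The number of diagonals of `Q'` strictly below `d`.
  have hcard := hE'.card_within_eq (fun f hf => Q'.cellSize_eq hf) (Finset.mem_insert_of_mem hdQ)
  rw [IsDissection.within_eq_insert (E := withRoot _ _) (a := d.1) (b := d.2)
    (Finset.mem_insert_of_mem hdQ), Finset.card_insert_of_notMem (by simp [mem_within])] at hcard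
  -- Upper bounds for the number of diagonals of `Q` in the three parts.
  have hm : ∀ f ∈ Q.diags, m ∣ f.2 - f.1 - 1 := fun f hf => Q.dvd_length hf
  have c1 := hQ.card_within_le hm hx.1
  have c2 := hQ.card_within_le hm hlt
  have c3 := hQ.card_within_le hm hx'.2
  -- The middle part has length divisible by `m`, which improves the bound by `m - 1`.
  have c2' : e.2 + m * (within Q.diags e.2 e'.2).card + m ≤ e'.2 := by
    obtain ⟨k, hk⟩ := dvd_length_of_mem_fan hef
    obtain ⟨k', hk'⟩ := dvd_length_of_mem_fan hef'
    set c := (within Q.diags e.2 e'.2).card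
    have h1 : m * (k + c) < m * k' := by
      rw [mul_add]
      omega
    have h2 := Nat.mul_le_mul_left m (Nat.lt_of_mul_lt_mul_left h1)
    rw [Nat.succ_eq_add_one, mul_add, mul_add, mul_one] at h2
    omega
  have hsub : within ((withRoot (m * n + 2) Q'.diags).erase (d.1, d.2)) d.1 d.2 ⊆
      within Q.diags d.1 e.2 ∪ within Q.diags e.2 e'.2 ∪ within Q.diags e'.2 d.2 := by
    intro f hf
    obtain ⟨hf, hf1, hf2⟩ := mem_within.1 hf
    obtain ⟨hfne, hf⟩ := Finset.mem_erase.1 hf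
    have hfQ' : f ∈ Q'.diags := mem_of_mem_withRoot (two_lt_card_vertices m n) Q'.isDiagonal
      (Finset.mem_insert_of_mem hdQ) hf hfne hf1 hf2
    have hfo : f ∈ Q'.offFan := mem_offFan.2 ⟨hfQ', fun h => by
      have := fst_eq_zero_of_mem_fan h
      omega⟩
    have hfQ := hmin f hfo hf1 hf2 hfne
    have hflt := (Q'.isDiagonal f hfQ').1
    have n1 := (not_crosses_iff (by omega)).1 (Q.noncrossing e he f hfQ)
    have n2 := (not_crosses_iff (by omega)).1 (Q.noncrossing e' he' f hfQ)
    simp only [Finset.mem_union, mem_within, hfQ, true_and]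
    omega
  have hcard' := (Finset.card_le_card hsub).trans (Finset.card_union_le _ _)
  have hcard'' := hcard'.trans (Nat.add_le_add_right (Finset.card_union_le _ _) _)
  have hmul := Nat.mul_le_mul_left m hcard''
  rw [mul_add, mul_add] at hmul
  rw [mul_add, mul_one] at hcard
  omega

/-- If the diagonals of `Q` off the fan form a proper subset of those of `Q'`, then some flip of a
fan diagonal of `Q` creates a diagonal of `Q'`. -/
theorem exists_flipUp {Q Q' : MAngulation m n} (h : Q.offFan ⊂ Q'.offFan) :
    ∃ Q₁, FlipUp Q Q₁ ∧ Q.offFan ⊂ Q₁.offFan ∧ Q₁.offFan ⊆ Q'.offFan := by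
  classical
  obtain ⟨hsub, hnot⟩ := h
  obtain ⟨d₀, hd₀, hd₀'⟩ := Finset.not_subset.1 hnot
  obtain ⟨d, hd, hmin⟩ := Finset.exists_min_image (Q'.offFan \ Q.offFan)
    (fun d => d.2 - d.1) ⟨d₀, Finset.mem_sdiff.2 ⟨hd₀, hd₀'⟩⟩
  obtain ⟨hd, hdo⟩ := Finset.mem_sdiff.1 hd
  obtain ⟨hdQ', hdf⟩ := mem_offFan.1 hd
  have hdQ : d ∉ Q.diags := fun h => hdo (mem_offFan.2 ⟨h, hdf⟩)
  have hmin' : ∀ f ∈ Q'.offFan, d.1 ≤ f.1 → f.2 ≤ d.2 → f ≠ d → f ∈ Q.diags := by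
    intro f hf h1 h2 hne
    by_contra hfQ
    have h3 := hmin f (Finset.mem_sdiff.2 ⟨hf, fun h => hfQ (mem_offFan.1 h).1⟩)
    have h4 := (Q'.isDiagonal f (mem_offFan.1 hf).1).1
    exact hne (Prod.ext (by omega) (by omega))
  have hfan : ∀ e ∈ Q.diags, Crosses d e → e ∈ fan m n := by
    intro e he hc
    by_contra hef
    exact Q'.noncrossing d hdQ' e (mem_offFan.1 (hsub (mem_offFan.2 ⟨he, hef⟩))).1 hc
  have hdD := Q'.isDiagonal d hdQ'
  have hdm := Q'.dvd_length hdQ'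
  obtain ⟨e, he, hc⟩ : ∃ e ∈ Q.diags, Crosses d e := by
    by_contra hno
    exact hdQ (Q.mem_of_not_crosses hdD hdm fun e he hc => hno ⟨e, he, hc⟩)
  have huniq : ∀ f ∈ Q.diags.erase e, ¬ Crosses d f := by
    intro f hf hcf
    obtain ⟨hne, hf⟩ := Finset.mem_erase.1 hf
    exact hne (eq_of_crosses_of_shortest hd hmin' hf he (hfan f hf hcf) (hfan e he hc) hcf hc)
  have hQ : IsDissection (Q.diags.erase e) :=
    Q.isDissection.mono ((Finset.erase_subset _ _).trans (Finset.subset_insert _ _))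
  have hdQe : d ∉ Q.diags.erase e := fun h => hdQ (Finset.mem_of_mem_erase h)
  let Q₁ : MAngulation m n := ofCard (insert d (Q.diags.erase e))
    ((Finset.forall_mem_insert _ _ _).2
      ⟨hdD, fun f hf => Q.isDiagonal f (Finset.mem_of_mem_erase hf)⟩)
    (hQ.insert_chord hdD.1 huniq).noncrossing
    ((Finset.forall_mem_insert _ _ _).2
      ⟨hdm, fun f hf => Q.dvd_length (Finset.mem_of_mem_erase hf)⟩)
    (by rw [Finset.card_insert_of_notMem hdQe, Finset.card_erase_add_one he, Q.card_diags])
  have hflip : FlipUp Q Q₁ := ⟨e, he, hfan e he hc, d, hdQ, rfl⟩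
  refine ⟨Q₁, hflip, ⟨hflip.offFan_subset, fun h => hdo (h ?_)⟩, fun f hf => ?_⟩
  · exact mem_offFan.2 ⟨Finset.mem_insert_self _ _, hdf⟩
  · obtain ⟨hf, hff⟩ := mem_offFan.1 hf
    rcases Finset.mem_insert.1 hf with rfl | hf
    · exact hd
    · exact hsub (mem_offFan.2 ⟨Finset.mem_of_mem_erase hf, hff⟩)

theorem ple_iff_offFan_subset {Q Q' : MAngulation m n} : PLE Q Q' ↔ Q.offFan ⊆ Q'.offFan := by
  refine ⟨PLE.offFan_subset, fun h => ?_⟩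
  induction hk : (Q'.offFan \ Q.offFan).card using Nat.strong_induction_on generalizing Q with
  | _ k ih =>
  rcases h.eq_or_ssubset with h | h
  · rw [offFan_injective h]
    exact Relation.ReflTransGen.refl
  · obtain ⟨Q₁, hflip, hlt, hle⟩ := exists_flipUp h
    refine Relation.ReflTransGen.head hflip (ih _ ?_ hle rfl)
    rw [← hk]
    refine Finset.card_lt_card ⟨Finset.sdiff_subset_sdiff subset_rfl hlt.subset, fun h' => ?_⟩
    obtain ⟨d, hd, hd'⟩ := Finset.exists_of_ssubset hlt
    exact (Finset.mem_sdiff.1 (h' (Finset.mem_sdiff.2 ⟨hle hd, hd'⟩))).2 hd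

end MAngulation

/-! ### Divisibility of the polynomials -/

open MvPolynomial in
theorem prime_X_sub_X {σ : Type*} {p q : σ} (h : p ≠ q) :
    Prime (X p - X q : MvPolynomial σ ℚ) := by
  classical
  have h1 : (X p - X q : MvPolynomial σ ℚ)
      = sumSMulX (Finsupp.single p 1 - Finsupp.single q 1) := by
    simp [sumSMulX]
  have h2 : (Finsupp.single p 1 - Finsupp.single q 1 : σ →₀ ℚ) p = 1 := by
    simp [h.symm]
  rw [h1]
  refine (irreducible_sumSMulX _ ⟨p, ?_⟩ fun r hr => ?_).prime
  · rw [Finsupp.mem_support_iff, h2]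
    exact one_ne_zero
  · exact isUnit_of_dvd_one (h2 ▸ hr p)

open MvPolynomial in
/-- If `X p - X q` divides `X p' - X q'`, then the latter vanishes on the hyperplane where the
coordinates `p` and `q` agree, so that the two differences involve the same variables. -/
theorem eq_or_eq_of_X_sub_X_dvd {σ : Type*} {p q p' q' : σ} (hne : p' ≠ q')
    (h : (X p - X q : MvPolynomial σ ℚ) ∣ X p' - X q') : p = p' ∧ q = q' ∨ p = q' ∧ q = p' := by
  classical
  have key : ∀ f : σ → ℚ, f p = f q → f p' = f q' := by
    intro f hf
    obtain ⟨r, hr⟩ := h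
    have := congrArg (eval f) hr
    simp only [map_sub, map_mul, eval_X, hf, sub_self, zero_mul] at this
    exact sub_eq_zero.1 this
  have h1 := key (Pi.single p' 1)
  have h2 := key (Pi.single q' 1)
  simp only [Pi.single_apply] at h1 h2
  by_cases a1 : p = p' <;> by_cases a2 : q = q' <;> by_cases a3 : p = q' <;>
    by_cases a4 : q = p' <;> simp_all

theorem modEq_of_letter_eq {m a b : ℕ} [NeZero m] (ha : 0 < a) (hb : 0 < b)
    (h : letter m a = letter m b) : a ≡ b [MOD m] := by
  have hm := NeZero.pos m
  have h1 : a + m - 2 ≡ b + m - 2 [MOD m] := congrArg Fin.val h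
  have h2 := h1.add_right 2
  rw [show a + m - 2 + 2 = a + m by omega, show b + m - 2 + 2 = b + m by omega] at h2
  exact Nat.ModEq.add_right_cancel' m h2

theorem eq_of_modEq_of_sub_div_eq {m a b c : ℕ} (ha : c ≤ a) (hb : c ≤ b) (h : a ≡ b [MOD m])
    (hdiv : (a - c) / m = (b - c) / m) : a = b := by
  have h1 : a - c ≡ b - c [MOD m] := Nat.ModEq.add_right_cancel' c (by
    rwa [Nat.sub_add_cancel ha, Nat.sub_add_cancel hb])
  have h2 := Nat.div_add_mod (a - c) m
  have h3 := Nat.div_add_mod (b - c) m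
  rw [hdiv, h1] at h2
  omega

/-- The variable attached to the first end of a diagonal off the fan. -/
def lowVar (m n : ℕ) [NeZero m] [NeZero n] (d : ℕ × ℕ) : Fin m × Fin n :=
  (letter m d.1, Fin.ofNat n ((d.1 - 1) / m))

/-- The variable attached to the last end of a diagonal off the fan. -/
def highVar (m n : ℕ) [NeZero m] [NeZero n] (d : ℕ × ℕ) : Fin m × Fin n :=
  (letter m d.2, Fin.ofNat n ((d.2 - 2) / m))

namespace MAngulation

variable {m n : ℕ} [NeZero m] [NeZero n] {Q Q' : MAngulation m n} {d d' : ℕ × ℕ}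

theorem index_bounds (hd : d ∈ Q.offFan) :
    (d.1 - 1) / m < (d.2 - 2) / m ∧ (d.2 - 2) / m < n := by
  have hm := NeZero.pos m
  have h0 := fst_pos_of_mem_offFan hd
  have hdQ := (mem_offFan.1 hd).1
  obtain ⟨h1, h2, -⟩ := Q.isDiagonal d hdQ
  have h3 := Nat.le_of_dvd (by omega) (Q.dvd_length hdQ)
  constructor
  · rw [Nat.lt_iff_add_one_le, ← Nat.add_div_right _ hm]
    exact Nat.div_le_div_right (by omega)
  · rw [Nat.div_lt_iff_lt_mul hm, mul_comm]
    omega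

theorem crossedLabels_eq (hd : d ∈ Q.offFan) :
    crossedLabels m n d = Set.Icc ((d.1 - 1) / m + 1) ((d.2 - 2) / m) := by
  have hm := NeZero.pos m
  have h0 := fst_pos_of_mem_offFan hd
  have h1 := (Q.isDiagonal d (mem_offFan.1 hd).1).1
  have h2 := (index_bounds hd).2
  ext k
  have h3 : (d.1 - 1) / m + 1 ≤ k ↔ d.1 ≤ k * m := by
    rw [Nat.add_one_le_iff, Nat.div_lt_iff_lt_mul hm]
    omega
  have h4 : k ≤ (d.2 - 2) / m ↔ k * m + 1 < d.2 := by
    rw [Nat.le_div_iff_mul_le hm]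
    omega
  rw [Set.mem_Icc]
  simp only [crossedLabels, Set.mem_ofPred_eq, Crosses, Separates, fanDiag]
  generalize (d.1 - 1) / m = i at *
  generalize (d.2 - 2) / m = j at *
  omega

theorem diagPoly_eq (hd : d ∈ Q.offFan) :
    diagPoly m n d = MvPolynomial.X (highVar m n d) - MvPolynomial.X (lowVar m n d) := by
  have h := (index_bounds hd).1
  rw [diagPoly, if_neg (mem_offFan.1 hd).2, crossedLabels_eq hd, csSup_Icc h, csInf_Icc h]
  rfl

theorem snd_lowVar_lt (hd : d ∈ Q.offFan) : (lowVar m n d).2 < (highVar m n d).2 := by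
  obtain ⟨h1, h2⟩ := index_bounds hd
  rw [Fin.lt_def]
  simp only [lowVar, highVar, Fin.val_ofNat]
  rwa [Nat.mod_eq_of_lt h2, Nat.mod_eq_of_lt (h1.trans h2)]

theorem prime_diagPoly (hd : d ∈ Q.offFan) : Prime (diagPoly m n d) := by
  rw [diagPoly_eq hd]
  exact prime_X_sub_X fun h => (snd_lowVar_lt hd).ne (congrArg Prod.snd h).symm

/-- The linear forms of distinct diagonals off the fan are not associated: a diagonal is recovered
from the ordered pair of its variables, whose order is that of their indices. -/
theorem eq_of_diagPoly_dvd (hd : d ∈ Q.offFan) (hd' : d' ∈ Q'.offFan)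
    (h : diagPoly m n d ∣ diagPoly m n d') : d = d' := by
  have hlt := snd_lowVar_lt hd
  have hlt' := snd_lowVar_lt hd'
  rw [diagPoly_eq hd, diagPoly_eq hd'] at h
  rcases eq_or_eq_of_X_sub_X_dvd (fun h => hlt'.ne (congrArg Prod.snd h).symm) h with
    ⟨h1, h2⟩ | ⟨h1, h2⟩
  · obtain ⟨b1, b2⟩ := index_bounds hd
    obtain ⟨b1', b2'⟩ := index_bounds hd'
    have p0 := fst_pos_of_mem_offFan hd
    have p0' := fst_pos_of_mem_offFan hd'
    have p1 := (Q.isDiagonal d (mem_offFan.1 hd).1).1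
    have p1' := (Q'.isDiagonal d' (mem_offFan.1 hd').1).1
    obtain ⟨hl, hi⟩ := Prod.ext_iff.1 h2
    obtain ⟨hl', hi'⟩ := Prod.ext_iff.1 h1
    replace hi := congrArg Fin.val hi
    replace hi' := congrArg Fin.val hi'
    simp only [lowVar, highVar, Fin.val_ofNat] at hl hi hl' hi'
    rw [Nat.mod_eq_of_lt (b1.trans b2), Nat.mod_eq_of_lt (b1'.trans b2')] at hi
    rw [Nat.mod_eq_of_lt b2, Nat.mod_eq_of_lt b2'] at hi'
    exact Prod.ext
      (eq_of_modEq_of_sub_div_eq p0 p0' (modEq_of_letter_eq p0 p0' hl) hi)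
      (eq_of_modEq_of_sub_div_eq (by omega) (by omega)
        (modEq_of_letter_eq (by omega) (by omega) hl') hi')
  · rw [h1, h2] at hlt
    exact absurd hlt hlt'.asymm

theorem poly_eq_prod_offFan (Q : MAngulation m n) :
    Q.poly = ∏ d ∈ Q.offFan, diagPoly m n d := by
  refine (Finset.prod_subset Finset.sdiff_subset fun d hd hd' => ?_).symm
  rw [diagPoly, if_pos]
  by_contra hf
  exact hd' (mem_offFan.2 ⟨hd, hf⟩)

theorem poly_dvd_iff_offFan_subset : Q.poly ∣ Q'.poly ↔ Q.offFan ⊆ Q'.offFan := by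
  rw [poly_eq_prod_offFan, poly_eq_prod_offFan]
  refine ⟨fun h d hd => ?_, Finset.prod_dvd_prod_of_subset _ _ _⟩
  obtain ⟨d', hd', hdvd⟩ := (prime_diagPoly hd).exists_mem_finset_dvd
    ((Finset.dvd_prod_of_mem _ hd).trans h)
  rwa [eq_of_diagPoly_dvd hd hd' hdvd]

end MAngulation

theorem mainTheorem2 (m n : ℕ) [NeZero m] [NeZero n] :
    IsPartialOrder (MAngulation m n) MAngulation.PLE ∧
    Function.Injective (MAngulation.poly : MAngulation m n → MvPolynomial (Fin m × Fin n) ℚ) ∧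
    ∀ Q Q' : MAngulation m n, Q.poly ∣ Q'.poly ↔ MAngulation.PLE Q Q' := by
  have hdvd : ∀ Q Q' : MAngulation m n, Q.poly ∣ Q'.poly ↔ MAngulation.PLE Q Q' := fun Q Q' =>
    MAngulation.poly_dvd_iff_offFan_subset.trans MAngulation.ple_iff_offFan_subset.symm
  have hanti : ∀ Q Q' : MAngulation m n, MAngulation.PLE Q Q' → MAngulation.PLE Q' Q → Q = Q' :=
    fun Q Q' h h' => MAngulation.offFan_injective (h.offFan_subset.antisymm h'.offFan_subset)
  refine ⟨{ refl := fun _ => Relation.ReflTransGen.refl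
            trans := fun _ _ _ => Relation.ReflTransGen.trans
            antisymm := hanti }, fun Q Q' h => ?_, hdvd⟩
  exact hanti Q Q' ((hdvd Q Q').1 h.dvd) ((hdvd Q' Q).1 h.symm.dvd)
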